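/- A directed graph $E$ consists of a set $E^0$ of vertices, a set $E^1$ of edges and source and range maps $s,r:E^1\to E^0$. It is row-finite if every vertex emits only finitely many edges (sinks are allowed), and it has no multiple edges if two edges with the same source and the same range are equal. Its vertex matrix $B_E$ is the $E^0\times E^0$ matrix with $B_E(v,w)=\#\{e\in E^1: s(e)=v,\ r(e)=w\}$. Let $B$ be a square matrix, of possibly infinite size, with entries in $\{0,1\}$; write $B_i$ for its $i$-th row and $E_i$ for the row with $1$ in position $i$ and $0$ elsewhere. A matrix $C$ is a primitive transfer of $B$ if there are an index $p$ with $B_p\neq 0$ and distinct indices $k_1,\dots,k_r,m_1,\dots,m_s$ with $p\notin\{m_1,\dots,m_s\}$ and all $B_{m_i}\neq 0$ such that $$B_p=E_{k_1}+\cdots+E_{k_r}+B_{m_1}+\cdots+B_{m_s},$$ and $C$ is obtained from $B$ by replacing row $p$ by the row with $1$ exactly in the positions $k_1,\dots,k_r,m_1,\dots,m_s$. Two $0$-$1$ matrices $B$, $C$ with the same index set are primitively equivalent if there are matrices $B=D_1,\dots,D_q=C$ such that for each $1\le i\le q-1$ either $D_i$ is a primitive transfer of $D_{i+1}$, or $D_{i+1}$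 is a primitive transfer of $D_i$, or $D_i=PD_{i+1}P^{-1}$ for a permutation matrix $P$. Two graphs with no multiple edges are primitively equivalent if, after identifying their vertex sets by a bijection, their vertex matrices are primitively equivalent. For a row-finite graph $E$, $C^*(E)$ denotes the universal $C^*$-algebra generated by a Cuntz–Krieger $E$-family, that is, by mutually orthogonal projections $P_v$ $(v\in E^0)$ and partial isometries $S_e$ $(e\in E^1)$ with $S_e^*S_e=P_{r(e)}$ for all $e\in E^1$ and $P_v=\sum_{s(e)=v}S_eS_e^*$ for all $v\in s(E^1)$. **Theorem.** Let $E$ and $F$ be graphs with countably many vertices and no multiple edges, and let $E$ be row-finite. If $F$ is primitively equivalent to $E$, then $F$ is row-finite and $C^*(E)\cong C^*(F)$ as $C^*$-algebras. -/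

import Mathlib

open scoped ENNReal

universe u

/-- A directed graph: a set of vertices, a set of edges, and source and range maps. -/
structure DirectedGraph where
  /-- the vertices `E⁰` -/
  Vertex : Type u
  /-- the edges `E¹` -/
  Edge : Type u
  /-- the source map `s` -/
  source : Edge → Vertex
  /-- the range map `r` -/
  range : Edge → Vertex

namespace DirectedGraph

/-- Every vertex emits only finitely many edges (possibly none, in which case it is a sink). -/
def RowFinite (E : DirectedGraph.{u}) : Prop :=
  ∀ v : E.Vertex, {e : E.Edge | E.source e = v}.Finite

/-- Between two vertices there is at most one edge in each direction. -/
def NoMultipleEdges (E : DirectedGraph.{u}) : Prop :=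
  ∀ e f : E.Edge, E.source e = E.source f → E.range e = E.range f → e = f

/-- The vertex matrix: its `(v, w)` entry is the number of edges from `v` to `w`. (That number is
finite when the graph is row-finite or has no multiple edges.) -/
noncomputable def vertexMatrix (E : DirectedGraph.{u}) : Matrix E.Vertex E.Vertex ℕ :=
  fun v w => {e : E.Edge | E.source e = v ∧ E.range e = w}.ncard

end DirectedGraph

/-! ### Primitive equivalence of square zero-one matrices of arbitrary size -/

/-- All entries of the matrix are `0` or `1`. -/
def IsZeroOne {ι : Type u} (B : Matrix ι ι ℕ) : Prop :=
  ∀ i j, B i j = 0 ∨ B i j = 1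

open Classical in
/-- `C` is a primitive transfer of the zero-one matrix `B` at `p`: the row `B p` is not zero, it is
the sum of the unit rows `E_k`, `k ∈ K`, and of the nonzero rows `B m`, `m ∈ M`, where `K` and `M`
are disjoint finite sets of indices and `p ∉ M`; and `C` arises from `B` by replacing row `p` by the
row which has `1` exactly in the positions `K ∪ M`. -/
def IsPrimitiveTransferAt {ι : Type u} (B C : Matrix ι ι ℕ) (p : ι) : Prop :=
  IsZeroOne B ∧ B p ≠ 0 ∧
    ∃ K M : Finset ι, Disjoint K M ∧ p ∉ M ∧ (∀ m ∈ M, B m ≠ 0) ∧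
      B p = ∑ k ∈ K, (Pi.single k 1 : ι → ℕ) + ∑ m ∈ M, B m ∧
      ∀ i j, C i j = if i ≠ p then B i j else if j ∈ K ∪ M then 1 else 0

/-- `C` is a primitive transfer of `B`. -/
def IsPrimitiveTransfer {ι : Type u} (B C : Matrix ι ι ℕ) : Prop :=
  ∃ p, IsPrimitiveTransferAt B C p

/-- One step in a primitive equivalence of zero-one matrices: a primitive transfer in one of the two
directions, or a simultaneous permutation of rows and columns. -/
def PrimitiveStep {ι : Type u} (D D' : Matrix ι ι ℕ) : Prop :=
  IsPrimitiveTransfer D' D ∨ IsPrimitiveTransfer D D' ∨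
    ∃ σ : Equiv.Perm ι, D = D'.submatrix σ σ

/-- Primitive equivalence of zero-one square matrices with the same index set: they are joined by a
finite chain of primitive steps. -/
def Matrix.PrimitivelyEquivalent {ι : Type u} (B C : Matrix ι ι ℕ) : Prop :=
  IsZeroOne B ∧ IsZeroOne C ∧ Relation.ReflTransGen PrimitiveStep B C

/-- Two graphs are primitively equivalent if their vertex matrices are, after an identification of
the two vertex sets. (As permutations are among the primitive steps, the choice of the
identification does not matter.) -/
def DirectedGraph.PrimitivelyEquivalent (E F : DirectedGraph.{u}) : Prop :=
  ∃ σ : E.Vertex ≃ F.Vertex,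
    Matrix.PrimitivelyEquivalent E.vertexMatrix (F.vertexMatrix.submatrix σ σ)

/-! ### The `C⋆`-algebra of a row-finite graph -/

/-- A Cuntz–Krieger `E`-family in a `C⋆`-algebra `A`, for a row-finite graph `E`. -/
structure CuntzKriegerFamily (E : DirectedGraph.{u}) (hE : E.RowFinite) (A : Type*)
    [NonUnitalCStarAlgebra A] where
  /-- the projections `P_v` -/
  P : E.Vertex → A
  /-- the partial isometries `S_e` -/
  S : E.Edge → A
  isStarProjection : ∀ v, IsStarProjection (P v)
  orthogonal : ∀ v w, v ≠ w → P v * P w = 0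
  partialIsometry : ∀ e, S e * star (S e) * S e = S e
  star_mul_self : ∀ e, star (S e) * S e = P (E.range e)
  sum_mul_star : ∀ v ∈ Set.range E.source, P v = ∑ e ∈ (hE v).toFinset, S e * star (S e)

namespace CuntzKriegerFamily

variable {E : DirectedGraph.{u}} {hE : E.RowFinite}

theorem norm_P_le {A : Type*} [NonUnitalCStarAlgebra A] (x : CuntzKriegerFamily E hE A)
    (v : E.Vertex) : ‖x.P v‖ ≤ 1 :=
  (x.isStarProjection v).norm_le

theorem norm_S_le {A : Type*} [NonUnitalCStarAlgebra A] (x : CuntzKriegerFamily E hE A)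
    (e : E.Edge) : ‖x.S e‖ ≤ 1 := by
  have h := CStarRing.norm_star_mul_self (x := x.S e)
  rw [x.star_mul_self] at h
  have := x.norm_P_le (E.range e)
  nlinarith [norm_nonneg (x.S e)]

end CuntzKriegerFamily

/-- A Cuntz–Krieger `E`-family together with a `C⋆`-algebra in which it lives. A `C⋆`-algebra
that is generated by a family indexed by the vertices and edges of `E` has a copy whose underlying
type is in the universe of `E`, so all Cuntz–Krieger families are represented here. -/
structure CuntzKriegerRep (E : DirectedGraph.{u}) (hE : E.RowFinite) where
  /-- the ambient `C⋆`-algebra -/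
  Carrier : Type u
  [cstar : NonUnitalCStarAlgebra Carrier]
  /-- the Cuntz–Krieger family -/
  family : CuntzKriegerFamily E hE Carrier

attribute [instance] CuntzKriegerRep.cstar

namespace DirectedGraph

variable (E : DirectedGraph.{u}) (hE : E.RowFinite)

/-- The `C⋆`-algebra of bounded families, indexed by all Cuntz–Krieger `E`-families, of elements of
the respective `C⋆`-algebras, with the supremum norm. -/
abbrev CuntzKriegerProduct : Type (u + 1) :=
  lp (fun x : CuntzKriegerRep E hE => x.Carrier) ∞

/-- The element of the product whose coordinate at each Cuntz–Krieger family is its `P_v`. -/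
noncomputable def productP (v : E.Vertex) : CuntzKriegerProduct E hE :=
  ⟨fun x => x.family.P v, memℓp_infty ⟨1, by rintro _ ⟨x, rfl⟩; exact x.family.norm_P_le v⟩⟩

/-- The element of the product whose coordinate at each Cuntz–Krieger family is its `S_e`. -/
noncomputable def productS (e : E.Edge) : CuntzKriegerProduct E hE :=
  ⟨fun x => x.family.S e, memℓp_infty ⟨1, by rintro _ ⟨x, rfl⟩; exact x.family.norm_S_le e⟩⟩

/-- `C⋆(E)`, the universal `C⋆`-algebra generated by a Cuntz–Krieger `E`-family, as the closed
`⋆`-subalgebra, generated by the universal Cuntz–Krieger family, of the product over all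
Cuntz–Krieger families. -/
noncomputable def graphCStarAlgebra : NonUnitalStarSubalgebra ℂ (CuntzKriegerProduct E hE) :=
  (NonUnitalStarAlgebra.adjoin ℂ
    (Set.range (E.productP hE) ∪ Set.range (E.productS hE))).topologicalClosure

noncomputable instance : NonUnitalCStarAlgebra (E.graphCStarAlgebra hE) :=
  NonUnitalStarSubalgebra.nonUnitalCStarAlgebra _
    (h_closed := NonUnitalStarSubalgebra.isClosed_topologicalClosure _)

/-- The Cuntz–Krieger family that generates `C⋆(E)`. -/
noncomputable def universalFamily : CuntzKriegerFamily E hE (E.graphCStarAlgebra hE) where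
  P v := ⟨E.productP hE v, NonUnitalStarSubalgebra.le_topologicalClosure _
    (NonUnitalStarAlgebra.subset_adjoin ℂ _ (Or.inl ⟨v, rfl⟩))⟩
  S e := ⟨E.productS hE e, NonUnitalStarSubalgebra.le_topologicalClosure _
    (NonUnitalStarAlgebra.subset_adjoin ℂ _ (Or.inr ⟨e, rfl⟩))⟩
  isStarProjection v :=
    ⟨Subtype.ext <| lp.ext <| funext fun x => (x.family.isStarProjection v).isIdempotentElem,
      Subtype.ext <| lp.ext <| funext fun x => (x.family.isStarProjection v).isSelfAdjoint⟩
  orthogonal v w h := Subtype.ext <| lp.ext <| funext fun x => x.family.orthogonal v w h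
  partialIsometry e := Subtype.ext <| lp.ext <| funext fun x => x.family.partialIsometry e
  star_mul_self e := Subtype.ext <| lp.ext <| funext fun x => x.family.star_mul_self e
  sum_mul_star v hv := by
    refine Subtype.ext <| lp.ext <| funext fun x => ?_
    rw [AddSubmonoidClass.coe_finsetSum, lp.coeFn_sum, Finset.sum_apply]
    exact x.family.sum_mul_star v hv

/-- The universal property of `C⋆(E)`. -/
theorem existsUnique_lift {A : Type u} [NonUnitalCStarAlgebra A] (x : CuntzKriegerFamily E hE A) :
    ∃! π : E.graphCStarAlgebra hE →⋆ₙₐ[ℂ] A,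
      (∀ v, π ((E.universalFamily hE).P v) = x.P v) ∧
        ∀ e, π ((E.universalFamily hE).S e) = x.S e := by
  let i : CuntzKriegerRep E hE := ⟨A, x⟩
  let ρ : E.graphCStarAlgebra hE →⋆ₙₐ[ℂ] A :=
    { toFun := fun a => (a : CuntzKriegerProduct E hE) i
      map_smul' := fun _ _ => rfl
      map_zero' := rfl
      map_add' := fun _ _ => rfl
      map_mul' := fun _ _ => rfl
      map_star' := fun _ => rfl }
  refine ⟨ρ, ⟨fun _ => rfl, fun _ => rfl⟩, fun π hπ => ?_⟩
  let T := NonUnitalStarAlgHom.equalizer (R := ℂ) π ρ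
  let U := T.map (NonUnitalStarSubalgebraClass.subtype (E.graphCStarAlgebra hE))
  have hcont : ∀ φ : E.graphCStarAlgebra hE →⋆ₙₐ[ℂ] A, Continuous φ := fun φ =>
    AddMonoidHomClass.continuous_of_bound φ 1 (by
      simpa only [one_mul] using NonUnitalStarAlgHom.norm_apply_le φ)
  have hT : IsClosed (T : Set (E.graphCStarAlgebra hE)) := isClosed_eq (hcont π) (hcont ρ)
  have hU : IsClosed (U : Set (CuntzKriegerProduct E hE)) :=
    (NonUnitalStarSubalgebra.isClosed_topologicalClosure _).isClosedEmbedding_subtypeVal.isClosedMap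
      _ hT
  have hle : E.graphCStarAlgebra hE ≤ U := by
    refine NonUnitalStarSubalgebra.topologicalClosure_minimal _
      (NonUnitalStarAlgebra.adjoin_le ?_) hU
    rintro _ (⟨v, rfl⟩ | ⟨e, rfl⟩)
    · exact ⟨(E.universalFamily hE).P v, hπ.1 v, rfl⟩
    · exact ⟨(E.universalFamily hE).S e, hπ.2 e, rfl⟩
  ext a
  obtain ⟨b, hb, hba⟩ := hle a.2
  have : b = a := Subtype.ext hba
  exact this ▸ hb

end DirectedGraph

/-! A `⋆`-isomorphism is obtained without computing in either algebra: `C⋆(E)` represents the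
functor taking a `C⋆`-algebra to its Cuntz–Krieger `E`-families, so a natural bijection between the
families of two graphs suffices (`nonempty_starAlgEquiv_of_natural`).

Let `C` be the primitive transfer of `B` at `p`, with sets `K` and `M`. The vertex projections and
all partial isometries of rows other than `p` or of columns in `K` are kept. For `m ∈ M` put T_{p,m}
= ∑_l S_{p,l} S_{m,l}^*, over the `l` with `B m l ≠ 0`; conversely S_{p,l} = T_{p,m} T_{m,l} for the
unique such `m`. The entries of `B` are at most 1, so the support of `B p` is the disjoint union of
`K` and the supports of the `B m`; hence the Cuntz–Krieger sums at `p` agree block by block. As `B m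
≠ 0`, the sum of the S_{m,l} S_{m,l}^* is P_m, which makes T_{p,m} a partial isometry with initial
projection P_m and the two constructions mutually inverse.

Row-finiteness passes both ways because `K` and `M` are finite. A chain of transfers and
relabellings then gives the theorem. -/

/-! ### Projections in a `C⋆`-algebra and their finite sums. -/

section StarProjection

variable {A : Type*} [NonUnitalCStarAlgebra A]

/-- In a `C⋆`-algebra, a finite sum of squares vanishes only if every summand does. -/
theorem eq_zero_of_sum_star_mul_self_eq_zero {κ : Type*} {s : Finset κ} {a : κ → A}
    (h : ∑ i ∈ s, star (a i) * a i = 0) {i : κ} (hi : i ∈ s) : a i = 0 := by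
  let _ := CStarAlgebra.spectralOrder A
  have := CStarAlgebra.spectralOrderedRing A
  exact CStarRing.star_mul_self_eq_zero_iff _ |>.1
    ((Finset.sum_eq_zero_iff_of_nonneg fun j _ => star_mul_self_nonneg (a j)).1 h i hi)

/-- An element whose square is a projection is a partial isometry with that initial projection. -/
theorem mul_eq_self_of_star_mul_self_eq {a p : A} (hp : IsStarProjection p)
    (h : star a * a = p) : a * p = a := by
  rw [← sub_eq_zero, ← CStarRing.star_mul_self_eq_zero_iff]
  have h1 : p * p = p := hp.isIdempotentElem
  have h2 : star p = p := hp.isSelfAdjoint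
  simp only [star_sub, star_mul, h2, sub_mul, mul_sub, h]
  rw [mul_assoc, ← mul_assoc (star a), h]
  simp [mul_assoc, h, h1]

/-- Projections whose sum is a projection `p` are dominated by `p`. -/
theorem mul_eq_self_of_sum_eq {κ : Type*} {s : Finset κ} {q : κ → A} {p : A}
    (hq : ∀ i ∈ s, IsStarProjection (q i)) (hp : IsStarProjection p) (h : p = ∑ i ∈ s, q i)
    {i : κ} (hi : i ∈ s) : q i * p = q i := by
  have h1 : p * p = p := hp.isIdempotentElem
  have h2 : star p = p := hp.isSelfAdjoint
  -- Each term is (1 - p) q_j (1 - p), written without a unit; the terms add up to (1 - p) p (1 - p)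
  -- = 0.
  have key : ∑ j ∈ s, star (q j * p - q j) * (q j * p - q j) = 0 := by
    have : ∀ j ∈ s, star (q j * p - q j) * (q j * p - q j)
        = p * q j * p - p * q j - q j * p + q j := by
      intro j hj
      have h3 : q j * q j = q j := (hq j hj).isIdempotentElem
      have h4 : star (q j) = q j := (hq j hj).isSelfAdjoint
      simp only [star_sub, star_mul, h2, h4, sub_mul, mul_sub]
      rw [show p * q j * (q j * p) = p * (q j * q j) * p by simp only [mul_assoc],
        show q j * (q j * p) = q j * q j * p by simp only [mul_assoc],
        show p * q j * q j = p * (q j * q j) by simp only [mul_assoc], h3]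
      abel
    rw [Finset.sum_congr rfl this, Finset.sum_add_distrib, Finset.sum_sub_distrib,
      Finset.sum_sub_distrib, ← Finset.sum_mul, ← Finset.mul_sum, ← Finset.sum_mul, ← h]
    simp [h1]
  exact sub_eq_zero.1 (eq_zero_of_sum_star_mul_self_eq_zero key hi)

/-- Projections whose sum is a projection are mutually orthogonal. -/
theorem mul_eq_zero_of_sum_eq {κ : Type*} {s : Finset κ} {q : κ → A} {p : A}
    (hq : ∀ i ∈ s, IsStarProjection (q i)) (hp : IsStarProjection p) (h : p = ∑ i ∈ s, q i)
    {i j : κ} (hi : i ∈ s) (hj : j ∈ s) (hij : i ≠ j) : q i * q j = 0 := by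
  classical
  have h1 : ∀ i ∈ s, q i * q i = q i := fun i hi => (hq i hi).isIdempotentElem
  have h2 : ∀ i ∈ s, star (q i) = q i := fun i hi => (hq i hi).isSelfAdjoint
  -- Compressing ∑ q_k = p by q_j gives ∑ q_j q_k q_j = q_j, and the term k = j already equals q_j.
  have key : ∑ k ∈ s.erase j, star (q k * q j) * (q k * q j) = 0 := by
    have e : ∀ k ∈ s, star (q k * q j) * (q k * q j) = q j * q k * q j := by
      intro k hk
      rw [star_mul, h2 k hk, h2 j hj, show q j * q k * (q k * q j) = q j * (q k * q k) * q j by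
        simp only [mul_assoc], h1 k hk]
    have t : ∑ k ∈ s, q j * q k * q j = q j := by
      rw [← Finset.sum_mul, ← Finset.mul_sum, ← h, mul_eq_self_of_sum_eq hq hp h hj, h1 j hj]
    rw [← Finset.add_sum_erase s _ hj, h1 j hj, h1 j hj] at t
    rw [Finset.sum_congr rfl fun k hk => e k (Finset.mem_of_mem_erase hk)]
    simpa using t
  exact eq_zero_of_sum_star_mul_self_eq_zero key (Finset.mem_erase.2 ⟨hij, hi⟩)

end StarProjection

/-! ### Functoriality of Cuntz–Krieger families and the universal property. -/

namespace CuntzKriegerFamily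

variable {E F : DirectedGraph.{u}} {hE : E.RowFinite} {hF : F.RowFinite}
  {A B : Type*} [NonUnitalCStarAlgebra A] [NonUnitalCStarAlgebra B]

theorem ext {x y : CuntzKriegerFamily E hE A} (hP : ∀ v, x.P v = y.P v)
    (hS : ∀ e, x.S e = y.S e) : x = y := by
  obtain ⟨P, S⟩ := x
  obtain ⟨P', S'⟩ := y
  obtain rfl : P = P' := funext hP
  obtain rfl : S = S' := funext hS
  rfl

/-- The image of a Cuntz–Krieger family under a homomorphism. -/
def map (x : CuntzKriegerFamily E hE A) (φ : A →⋆ₙₐ[ℂ] B) : CuntzKriegerFamily E hE B where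
  P v := φ (x.P v)
  S e := φ (x.S e)
  isStarProjection v := (x.isStarProjection v).map φ
  orthogonal v w h := by rw [← map_mul, x.orthogonal v w h, map_zero]
  partialIsometry e := by rw [← map_star, ← map_mul, ← map_mul, x.partialIsometry]
  star_mul_self e := by rw [← map_star, ← map_mul, x.star_mul_self]
  sum_mul_star v hv := by
    simp only [x.sum_mul_star v hv, map_sum, map_mul, map_star]

/-- The transport of a Cuntz–Krieger family along an isomorphism of graphs. -/
def transport (σ : E.Vertex ≃ F.Vertex) (τ : E.Edge ≃ F.Edge)
    (hs : ∀ e, F.source (τ e) = σ (E.source e)) (hr : ∀ e, F.range (τ e) = σ (E.range e))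
    (x : CuntzKriegerFamily F hF A) : CuntzKriegerFamily E hE A where
  P v := x.P (σ v)
  S e := x.S (τ e)
  isStarProjection v := x.isStarProjection _
  orthogonal v w h := x.orthogonal _ _ (σ.injective.ne h)
  partialIsometry e := x.partialIsometry _
  star_mul_self e := by rw [x.star_mul_self, hr]
  sum_mul_star v hv := by
    obtain ⟨e, rfl⟩ := hv
    rw [x.sum_mul_star _ ⟨τ e, hs e⟩]
    refine (Finset.sum_equiv τ (fun i => ?_) fun _ _ => rfl).symm
    simp [hs]

theorem S_mul_P (x : CuntzKriegerFamily E hE A) (e : E.Edge) :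
    x.S e * x.P (E.range e) = x.S e :=
  mul_eq_self_of_star_mul_self_eq (x.isStarProjection _) (x.star_mul_self e)

end CuntzKriegerFamily

namespace DirectedGraph

section Lift

variable {E F : DirectedGraph.{u}} {hE : E.RowFinite} {hF : F.RowFinite}

/-- `C⋆(E)` is closed in the product, so the image of `T` there is closed as well and contains the
closure of the algebra generated by the universal family. -/
theorem eq_top_of_isClosed_of_mem {T : NonUnitalStarSubalgebra ℂ (E.graphCStarAlgebra hE)}
    (hT : IsClosed (T : Set (E.graphCStarAlgebra hE)))
    (hP : ∀ v, (E.universalFamily hE).P v ∈ T) (hS : ∀ e, (E.universalFamily hE).S e ∈ T)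
    (a : E.graphCStarAlgebra hE) : a ∈ T := by
  let U := T.map (NonUnitalStarSubalgebraClass.subtype (E.graphCStarAlgebra hE))
  have hU : IsClosed (U : Set (CuntzKriegerProduct E hE)) :=
    (NonUnitalStarSubalgebra.isClosed_topologicalClosure _).isClosedEmbedding_subtypeVal.isClosedMap
      _ hT
  have hle : E.graphCStarAlgebra hE ≤ U := by
    refine NonUnitalStarSubalgebra.topologicalClosure_minimal _
      (NonUnitalStarAlgebra.adjoin_le ?_) hU
    rintro _ (⟨v, rfl⟩ | ⟨e, rfl⟩)
    · exact ⟨_, hP v, rfl⟩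
    · exact ⟨_, hS e, rfl⟩
  obtain ⟨b, hb, hba⟩ := hle a.2
  have : b = a := Subtype.ext hba
  exact this ▸ hb

theorem continuous_starAlgHom {A B : Type*} [NonUnitalCStarAlgebra A] [NonUnitalCStarAlgebra B]
    (φ : A →⋆ₙₐ[ℂ] B) : Continuous φ :=
  AddMonoidHomClass.continuous_of_bound φ 1 (by
    simpa only [one_mul] using NonUnitalStarAlgHom.norm_apply_le φ)

/-- Homomorphisms on `C⋆(E)` that agree on the generators are equal. -/
theorem hom_ext {A : Type*} [NonUnitalCStarAlgebra A] {φ ψ : E.graphCStarAlgebra hE →⋆ₙₐ[ℂ] A}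
    (h : (E.universalFamily hE).map φ = (E.universalFamily hE).map ψ) : φ = ψ := by
  ext a
  exact eq_top_of_isClosed_of_mem (T := NonUnitalStarAlgHom.equalizer (R := ℂ) φ ψ)
    (isClosed_eq (continuous_starAlgHom φ) (continuous_starAlgHom ψ))
    (fun v => congrFun (congrArg CuntzKriegerFamily.P h) v)
    (fun e => congrFun (congrArg CuntzKriegerFamily.S h) e) a

/-- The coordinate of `C⋆(F)` at a Cuntz–Krieger family. -/
noncomputable def evalHom (y : CuntzKriegerRep F hF) :
    F.graphCStarAlgebra hF →⋆ₙₐ[ℂ] y.Carrier where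
  toFun a := (a : CuntzKriegerProduct F hF) y
  map_smul' _ _ := rfl
  map_zero' := rfl
  map_add' _ _ := rfl
  map_mul' _ _ := rfl
  map_star' _ := rfl

/-- The homomorphism from `C⋆(E)` to the product over all Cuntz–Krieger `F`-families that is
given by a Cuntz–Krieger `E`-family in `C⋆(F)`. -/
noncomputable def liftProduct (x : CuntzKriegerFamily E hE (F.graphCStarAlgebra hF)) :
    E.graphCStarAlgebra hE →⋆ₙₐ[ℂ] CuntzKriegerProduct F hF where
  toFun a := ⟨fun y => (a : CuntzKriegerProduct E hE) ⟨y.Carrier, x.map (evalHom y)⟩,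
    memℓp_infty ⟨‖(a : CuntzKriegerProduct E hE)‖, by
      rintro _ ⟨y, rfl⟩
      exact lp.norm_apply_le_norm (by simp) (a : CuntzKriegerProduct E hE)
        ⟨y.Carrier, x.map (evalHom y)⟩⟩⟩
  map_smul' _ _ := rfl
  map_zero' := rfl
  map_add' _ _ := rfl
  map_mul' _ _ := rfl
  map_star' _ := rfl

/-- `C⋆(F)` lives one universe above the carriers over which `C⋆(E)` is formed, so
`existsUnique_lift` does not apply to it. The map is defined coordinatewise instead: each coordinate
of `C⋆(F)` lies in a small algebra and carries the image of `x`. -/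
theorem exists_lift (x : CuntzKriegerFamily E hE (F.graphCStarAlgebra hF)) :
    ∃ φ : E.graphCStarAlgebra hE →⋆ₙₐ[ℂ] F.graphCStarAlgebra hF,
      (E.universalFamily hE).map φ = x := by
  -- The preimage of `C⋆(F)` is closed, and it contains the generators because these are sent to the
  -- members of `x`.
  have h (a) : liftProduct x a ∈ F.graphCStarAlgebra hF := by
    refine eq_top_of_isClosed_of_mem (T := (F.graphCStarAlgebra hF).comap (liftProduct x))
      ?_ (fun v => ?_) (fun e => ?_) a
    · exact (NonUnitalStarSubalgebra.isClosed_topologicalClosure _).preimage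
        (continuous_starAlgHom (liftProduct x))
    · exact (x.P v).2
    · exact (x.S e).2
  refine ⟨NonUnitalStarAlgHom.codRestrict (liftProduct x) _ h, ?_⟩
  exact CuntzKriegerFamily.ext (fun _ => rfl) (fun _ => rfl)

/-- If Cuntz–Krieger families of `E` and of `F` are naturally in bijection, then `C⋆(E)` and
`C⋆(F)` are isomorphic. -/
theorem nonempty_starAlgEquiv_of_natural
    (f : ∀ {A : Type (u + 1)} [NonUnitalCStarAlgebra A],
      CuntzKriegerFamily E hE A → CuntzKriegerFamily F hF A)
    (g : ∀ {A : Type (u + 1)} [NonUnitalCStarAlgebra A],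
      CuntzKriegerFamily F hF A → CuntzKriegerFamily E hE A)
    (hf : ∀ {A B : Type (u + 1)} [NonUnitalCStarAlgebra A] [NonUnitalCStarAlgebra B]
      (φ : A →⋆ₙₐ[ℂ] B) (x : CuntzKriegerFamily E hE A), f (x.map φ) = (f x).map φ)
    (hg : ∀ {A B : Type (u + 1)} [NonUnitalCStarAlgebra A] [NonUnitalCStarAlgebra B]
      (φ : A →⋆ₙₐ[ℂ] B) (x : CuntzKriegerFamily F hF A), g (x.map φ) = (g x).map φ)
    (hgf : ∀ {A : Type (u + 1)} [NonUnitalCStarAlgebra A] (x : CuntzKriegerFamily E hE A),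
      g (f x) = x)
    (hfg : ∀ {A : Type (u + 1)} [NonUnitalCStarAlgebra A] (x : CuntzKriegerFamily F hF A),
      f (g x) = x) :
    Nonempty (E.graphCStarAlgebra hE ≃⋆ₐ[ℂ] F.graphCStarAlgebra hF) := by
  obtain ⟨φ, hφ⟩ := exists_lift (g (F.universalFamily hF))
  obtain ⟨ψ, hψ⟩ := exists_lift (f (E.universalFamily hE))
  -- On generators, naturality turns ψ ∘ φ into `g (f _)` applied to the universal family.
  have h1 : ψ.comp φ = NonUnitalStarAlgHom.id ℂ _ := hom_ext <| by
    change ((E.universalFamily hE).map φ).map ψ = E.universalFamily hE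
    rw [hφ, ← hg, hψ, hgf]
  have h2 : φ.comp ψ = NonUnitalStarAlgHom.id ℂ _ := hom_ext <| by
    change ((F.universalFamily hF).map ψ).map φ = F.universalFamily hF
    rw [hψ, ← hf, hφ, hfg]
  exact ⟨{ φ with
    invFun := ψ
    left_inv := fun a => DFunLike.congr_fun h1 a
    right_inv := fun a => DFunLike.congr_fun h2 a
    map_add' := map_add φ
    map_mul' := map_mul φ
    map_smul' := map_smul φ
    map_star' := map_star φ }⟩

/-- Isomorphic graphs have isomorphic `C⋆`-algebras. -/
theorem nonempty_starAlgEquiv_of_equiv (σ : E.Vertex ≃ F.Vertex) (τ : E.Edge ≃ F.Edge)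
    (hs : ∀ e, F.source (τ e) = σ (E.source e)) (hr : ∀ e, F.range (τ e) = σ (E.range e)) :
    Nonempty (E.graphCStarAlgebra hE ≃⋆ₐ[ℂ] F.graphCStarAlgebra hF) := by
  have hs' (e) : E.source (τ.symm e) = σ.symm (F.source e) := by
    rw [Equiv.eq_symm_apply, ← hs, Equiv.apply_symm_apply]
  have hr' (e) : E.range (τ.symm e) = σ.symm (F.range e) := by
    rw [Equiv.eq_symm_apply, ← hr, Equiv.apply_symm_apply]
  exact nonempty_starAlgEquiv_of_natural
    (fun x => x.transport σ.symm τ.symm hs' hr') (fun x => x.transport σ τ hs hr)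
    (fun _ _ => rfl) (fun _ _ => rfl)
    (fun x => CuntzKriegerFamily.ext
      (fun v => congrArg x.P (σ.symm_apply_apply v)) (fun e => congrArg x.S (τ.symm_apply_apply e)))
    (fun x => CuntzKriegerFamily.ext
      (fun v => congrArg x.P (σ.apply_symm_apply v)) (fun e => congrArg x.S (τ.apply_symm_apply e)))

theorem RowFinite.of_equiv (hF : F.RowFinite) (σ : E.Vertex ≃ F.Vertex) (τ : E.Edge ≃ F.Edge)
    (hs : ∀ e, F.source (τ e) = σ (E.source e)) : E.RowFinite := fun v =>
  ((hF (σ v)).preimage τ.injective.injOn).subset fun e he => by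
    simp only [Set.mem_ofPred_eq] at he
    simp [hs, he]

end Lift

end DirectedGraph

/-! ### Consequences of the Cuntz–Krieger relations. -/

namespace CuntzKriegerFamily

variable {E : DirectedGraph.{u}} {hE : E.RowFinite} {A : Type*} [NonUnitalCStarAlgebra A]

theorem isStarProjection_S_mul_star (x : CuntzKriegerFamily E hE A) (e : E.Edge) :
    IsStarProjection (x.S e * star (x.S e)) where
  isIdempotentElem := by
    rw [IsIdempotentElem, ← mul_assoc, x.partialIsometry]
  isSelfAdjoint := IsSelfAdjoint.mul_star_self _

theorem P_mul_S (x : CuntzKriegerFamily E hE A) (e : E.Edge) :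
    x.P (E.source e) * x.S e = x.S e := by
  have h := mul_eq_self_of_sum_eq (fun i _ => x.isStarProjection_S_mul_star i)
    (x.isStarProjection (E.source e)) (x.sum_mul_star _ ⟨e, rfl⟩) (i := e) (by simp)
  have h' := congrArg star h
  rw [star_mul, star_mul, star_star, (x.isStarProjection _).isSelfAdjoint.star_eq] at h'
  rw [← x.partialIsometry e, ← mul_assoc, h']

/-- The range projections of the edges leaving one vertex add up to a projection, so they are
mutually orthogonal; insert S = S S^* S in both factors. -/
theorem star_S_mul_S (x : CuntzKriegerFamily E hE A) {e f : E.Edge}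
    (h : E.source e = E.source f) (hef : e ≠ f) : star (x.S e) * x.S f = 0 := by
  have h0 := mul_eq_zero_of_sum_eq (fun i _ => x.isStarProjection_S_mul_star i)
    (x.isStarProjection (E.source e)) (x.sum_mul_star _ ⟨e, rfl⟩) (i := e) (j := f)
    (by simp) (by simp [h]) hef
  calc star (x.S e) * x.S f
      = star (x.S e * star (x.S e) * x.S e) * (x.S f * star (x.S f) * x.S f) := by
        rw [x.partialIsometry, x.partialIsometry]
    _ = star (x.S e) * (x.S e * star (x.S e) * (x.S f * star (x.S f))) * x.S f := by
        simp only [star_mul, star_star, mul_assoc]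
    _ = 0 := by rw [h0, mul_zero, zero_mul]

end CuntzKriegerFamily

/-! ### Graphs of matrices and their families in matrix notation. -/

/-- The graph without multiple edges whose edges are the nonzero entries of a matrix. -/
def DirectedGraph.ofMatrix {ι : Type u} (B : Matrix ι ι ℕ) : DirectedGraph.{u} where
  Vertex := ι
  Edge := {x : ι × ι // B x.1 x.2 ≠ 0}
  source e := e.1.1
  range e := e.1.2

namespace DirectedGraph

variable {ι : Type u} {B C : Matrix ι ι ℕ}

theorem rowFinite_ofMatrix_iff : (ofMatrix B).RowFinite ↔ ∀ i, {j | B i j ≠ 0}.Finite := by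
  constructor
  · refine fun h i => ((h i).image (ofMatrix B).range).subset fun j hj => ?_
    exact ⟨⟨(i, j), hj⟩, rfl, rfl⟩
  · refine fun h i => ((h i).image fun j => (i, j)).preimage
      (f := (Subtype.val : (ofMatrix B).Edge → ι × ι)) Subtype.val_injective.injOn |>.subset ?_
    rintro ⟨⟨a, j⟩, ha⟩ rfl
    exact ⟨j, ha, rfl⟩

theorem mem_range_source_ofMatrix_iff {i : ι} :
    i ∈ Set.range (ofMatrix B).source ↔ B i ≠ 0 := by
  rw [Function.ne_iff]
  exact ⟨fun ⟨e, he⟩ => ⟨e.1.2, he ▸ e.2⟩, fun ⟨j, hj⟩ => ⟨⟨(i, j), hj⟩, rfl⟩⟩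

/-- The positions of the nonzero entries of a row. -/
noncomputable def rowSupport (hB : (ofMatrix B).RowFinite) (i : ι) : Finset ι :=
  (rowFinite_ofMatrix_iff.1 hB i).toFinset

theorem mem_rowSupport {hB : (ofMatrix B).RowFinite} {i j : ι} :
    j ∈ rowSupport hB i ↔ B i j ≠ 0 := by
  simp [rowSupport]

theorem sum_edges_ofMatrix {A : Type*} [AddCommMonoid A] (hB : (ofMatrix B).RowFinite) (i : ι)
    {s : Finset ι} (hs : ∀ j, j ∈ s ↔ B i j ≠ 0) (f : ι → ι → A) :
    ∑ e ∈ (hB i).toFinset, f e.1.1 e.1.2 = ∑ j ∈ s, f i j := by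
  refine Finset.sum_bij (fun e _ => (ofMatrix B).range e) ?_ ?_ ?_ ?_
  · rintro ⟨⟨a, j⟩, ha⟩ h
    obtain rfl : a = i := (hB _).mem_toFinset.1 h
    exact (hs j).2 ha
  · rintro ⟨⟨a, j⟩, ha⟩ h1 ⟨⟨b, k⟩, hb⟩ h2 h3
    obtain rfl : a = i := (hB _).mem_toFinset.1 h1
    obtain rfl : b = a := (hB _).mem_toFinset.1 h2
    obtain rfl : j = k := h3
    rfl
  · intro j hj
    exact ⟨⟨(i, j), (hs j).1 hj⟩, (Set.Finite.mem_toFinset _).2 rfl, rfl⟩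
  · rintro ⟨⟨a, j⟩, ha⟩ h
    obtain rfl : a = i := (hB _).mem_toFinset.1 h
    rfl

end DirectedGraph

namespace CuntzKriegerFamily

open DirectedGraph

variable {ι : Type u} {B C : Matrix ι ι ℕ} {hB : (ofMatrix B).RowFinite}
  {hC : (ofMatrix C).RowFinite} {A A' : Type*} [NonUnitalCStarAlgebra A] [NonUnitalCStarAlgebra A']

open Classical in
/-- The matrix of the partial isometries of a Cuntz–Krieger family. -/
noncomputable def entry (x : CuntzKriegerFamily (ofMatrix B) hB A) (i j : ι) : A :=
  -- With the value `0` off the edges, all relations below except S^* S = P hold without a condition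
  -- on the entry.
  if h : B i j ≠ 0 then x.S ⟨(i, j), h⟩ else 0

/-- The projections of a Cuntz–Krieger family. -/
def diag (x : CuntzKriegerFamily (ofMatrix B) hB A) (i : ι) : A := x.P i

section Entry

variable (x : CuntzKriegerFamily (ofMatrix B) hB A) {i j l : ι}

theorem entry_of_ne (h : B i j ≠ 0) : x.entry i j = x.S ⟨(i, j), h⟩ := dif_pos h

theorem entry_of_eq (h : B i j = 0) : x.entry i j = 0 := dif_neg (not_not.2 h)

theorem star_entry_mul_entry (h : B i j ≠ 0) :
    star (x.entry i j) * x.entry i j = x.diag j := by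
  rw [x.entry_of_ne h]
  exact x.star_mul_self _

theorem entry_mul_diag : x.entry i j * x.diag j = x.entry i j := by
  by_cases h : B i j = 0
  · rw [x.entry_of_eq h, zero_mul]
  · rw [x.entry_of_ne h]
    exact x.S_mul_P ⟨(i, j), h⟩

theorem diag_mul_star_entry : x.diag j * star (x.entry i j) = star (x.entry i j) := by
  have h := congrArg star (x.entry_mul_diag (i := i) (j := j))
  rwa [star_mul, show star (x.diag j) = x.diag j from (x.isStarProjection j).isSelfAdjoint] at h

theorem diag_mul_entry : x.diag i * x.entry i j = x.entry i j := by
  by_cases h : B i j = 0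
  · rw [x.entry_of_eq h, mul_zero]
  · rw [x.entry_of_ne h]
    exact x.P_mul_S ⟨(i, j), h⟩

theorem star_entry_mul_entry_of_ne (h : j ≠ l) : star (x.entry i j) * x.entry i l = 0 := by
  by_cases hj : B i j = 0
  · rw [x.entry_of_eq hj, star_zero, zero_mul]
  by_cases hl : B i l = 0
  · rw [x.entry_of_eq hl, mul_zero]
  rw [x.entry_of_ne hj, x.entry_of_ne hl]
  refine x.star_S_mul_S rfl fun h' => h ?_
  exact congrArg (fun e => e.1.2) h'

/-- The set `s` is left free so that a row common to `B` and `C` can be summed over the row support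
of either matrix. -/
theorem diag_eq_sum (h : B i ≠ 0) {s : Finset ι} (hs : ∀ j, j ∈ s ↔ B i j ≠ 0) :
    x.diag i = ∑ j ∈ s, x.entry i j * star (x.entry i j) := by
  rw [← sum_edges_ofMatrix hB i hs fun i j => x.entry i j * star (x.entry i j)]
  refine (x.sum_mul_star i (mem_range_source_ofMatrix_iff.2 h)).trans ?_
  refine Finset.sum_congr rfl fun e _ => ?_
  exact (congrArg (fun a => a * star a) (x.entry_of_ne e.2)).symm

theorem ext_entry {x y : CuntzKriegerFamily (ofMatrix B) hB A} (hP : ∀ i, x.diag i = y.diag i)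
    (hS : ∀ i j, B i j ≠ 0 → x.entry i j = y.entry i j) : x = y := by
  refine ext hP fun e => ?_
  have := hS _ _ e.2
  rwa [x.entry_of_ne e.2, y.entry_of_ne e.2] at this

theorem map_entry (φ : A →⋆ₙₐ[ℂ] A') (i j : ι) : (x.map φ).entry i j = φ (x.entry i j) := by
  by_cases h : B i j = 0
  · rw [x.entry_of_eq h, entry_of_eq _ h, map_zero]
  · rw [x.entry_of_ne h, entry_of_ne _ h]
    rfl

end Entry

/-- A Cuntz–Krieger family from matrices of projections and partial isometries. -/
def ofEntries (hB : (ofMatrix B).RowFinite) (P : ι → A) (S : ι → ι → A)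
    (hP : ∀ i, IsStarProjection (P i))
    (hPP : ∀ i j, i ≠ j → P i * P j = 0) (hS : ∀ i j, B i j ≠ 0 → star (S i j) * S i j = P j)
    (hPS : ∀ i, B i ≠ 0 → P i = ∑ j ∈ rowSupport hB i, S i j * star (S i j)) :
    CuntzKriegerFamily (ofMatrix B) hB A where
  P := P
  S e := S e.1.1 e.1.2
  isStarProjection := hP
  orthogonal := hPP
  partialIsometry e := by
    rw [mul_assoc, hS _ _ e.2]
    exact mul_eq_self_of_star_mul_self_eq (hP _) (hS _ _ e.2)
  star_mul_self e := hS _ _ e.2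
  sum_mul_star i hi := by
    refine (hPS i (mem_range_source_ofMatrix_iff.1 hi)).trans ?_
    exact (sum_edges_ofMatrix hB i (fun j => mem_rowSupport)
      fun i j => S i j * star (S i j)).symm

end CuntzKriegerFamily

/-! ### Combinatorics of a primitive transfer. -/

/-- The relation between a zero-one matrix and its primitive transfer at `p`, in terms of the
supports of the rows. -/
structure IsTransferOfSupports {ι : Type u} (B C : Matrix ι ι ℕ) (p : ι) (K M : Finset ι) :
    Prop where
  disjoint : Disjoint K M
  notMem : p ∉ M
  row_ne : B p ≠ 0
  row_ne_of_mem : ∀ m ∈ M, B m ≠ 0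
  row_eq : ∀ i, i ≠ p → C i = B i
  source_ne_iff : ∀ j, B p j ≠ 0 ↔ j ∈ K ∨ ∃ m ∈ M, B m j ≠ 0
  target_ne_iff : ∀ j, C p j ≠ 0 ↔ j ∈ K ∨ j ∈ M
  eq_zero_of_mem : ∀ m ∈ M, ∀ j ∈ K, B m j = 0
  eq_zero_of_ne : ∀ m ∈ M, ∀ m' ∈ M, m' ≠ m → ∀ j, B m j ≠ 0 → B m' j = 0

/-- Two summands of `B p` that are both nonzero at `j` would force `B p j ≥ 2`; this yields the two
disjointness fields. -/
theorem IsPrimitiveTransferAt.exists_isTransferOfSupports {ι : Type u} {B C : Matrix ι ι ℕ} {p : ι}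
    (h : IsPrimitiveTransferAt B C p) : ∃ K M, IsTransferOfSupports B C p K M := by
  classical
  obtain ⟨h01, hp, K, M, hKM, hpM, hM, hsum, hC⟩ := h
  have hj (j) : B p j = (if j ∈ K then 1 else 0) + ∑ m ∈ M, B m j := by
    rw [hsum, Pi.add_apply, Finset.sum_apply]
    congr 1
    · simp [Pi.single_apply]
    · exact Finset.sum_apply j M B
  have hle (j) : B p j ≤ 1 := by rcases h01 p j with h | h <;> omega
  refine ⟨K, M, hKM, hpM, hp, hM, fun i hi => ?_, fun j => ?_, fun j => ?_, fun m hm j hjK => ?_,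
    fun m hm m' hm' hne j hmj => ?_⟩
  · funext j
    rw [hC, if_pos hi]
  · rw [hj, Ne, Nat.add_eq_zero_iff, Finset.sum_eq_zero_iff]
    by_cases hK : j ∈ K <;> simp [hK]
  · rw [hC, if_neg (not_not.2 rfl)]
    by_cases hK : j ∈ K <;> simp [hK]
  · have h1 := hj j
    have h2 := hle j
    have h3 := Finset.single_le_sum (f := fun m => B m j) (fun _ _ => Nat.zero_le _) hm
    rw [if_pos hjK] at h1
    have h4 : ∑ m ∈ M, B m j ≤ 1 := by omega
    have := h3.trans h4
    omega
  · have h1 := hj j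
    have h2 := hle j
    have h3 := Finset.add_le_sum (f := fun m => B m j) (fun _ _ => Nat.zero_le _) hm hm' hne.symm
    have h4 : ∑ m ∈ M, B m j ≤ 1 := by omega
    have := h3.trans h4
    omega

namespace IsTransferOfSupports

open DirectedGraph CuntzKriegerFamily

variable {ι : Type u} {B C : Matrix ι ι ℕ} {p : ι} {K M : Finset ι}

theorem rowFinite_iff (h : IsTransferOfSupports B C p K M) :
    (ofMatrix B).RowFinite ↔ (ofMatrix C).RowFinite := by
  rw [rowFinite_ofMatrix_iff, rowFinite_ofMatrix_iff]
  constructor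
  · intro hB i
    by_cases hi : i = p
    · subst hi
      exact (K.finite_toSet.union M.finite_toSet).subset fun j hj => (h.target_ne_iff j).1 hj
    · rw [h.row_eq i hi]
      exact hB i
  · intro hC i
    by_cases hi : i = p
    · subst hi
      refine (K.finite_toSet.union (M.finite_toSet.biUnion fun m _ => hC m)).subset fun j hj => ?_
      refine ((h.source_ne_iff j).1 hj).imp_right fun ⟨m, hm, hmj⟩ => ?_
      refine Set.mem_biUnion hm ?_
      change C m j ≠ 0
      rwa [h.row_eq m (ne_of_mem_of_not_mem hm h.notMem)]
    · rw [← h.row_eq i hi]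
      exact hC i

variable {hB : (ofMatrix B).RowFinite} {hC : (ofMatrix C).RowFinite} {A A' : Type*}
  [NonUnitalCStarAlgebra A] [NonUnitalCStarAlgebra A']

theorem ne_of_mem (h : IsTransferOfSupports B C p K M) {m : ι} (hm : m ∈ M) : m ≠ p :=
  ne_of_mem_of_not_mem hm h.notMem

/-- Ensures that `p` is not a sink for `C`, so that the Cuntz–Krieger sum at `p` is available in a
`C`-family. -/
theorem target_row_ne (h : IsTransferOfSupports B C p K M) : C p ≠ 0 := by
  obtain ⟨j, hj⟩ := Function.ne_iff.1 h.row_ne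
  rcases (h.source_ne_iff j).1 hj with hK | ⟨m, hm, -⟩
  · exact fun h0 => (h.target_ne_iff j).2 (Or.inl hK) (congrFun h0 j)
  · exact fun h0 => (h.target_ne_iff m).2 (Or.inr hm) (congrFun h0 m)

theorem rowSupport_target (h : IsTransferOfSupports B C p K M) [DecidableEq ι] :
    rowSupport hC p = K ∪ M := by
  ext j
  rw [mem_rowSupport, h.target_ne_iff, Finset.mem_union]

theorem rowSupport_source (h : IsTransferOfSupports B C p K M) [DecidableEq ι] :
    rowSupport hB p = K ∪ M.biUnion (rowSupport hB) := by
  ext j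
  simp only [mem_rowSupport, h.source_ne_iff, Finset.mem_union, Finset.mem_biUnion]

theorem sum_rowSupport_source (h : IsTransferOfSupports B C p K M) {G : Type*} [AddCommMonoid G]
    (f : ι → G) :
    ∑ j ∈ rowSupport hB p, f j = ∑ j ∈ K, f j + ∑ m ∈ M, ∑ j ∈ rowSupport hB m, f j := by
  classical
  rw [h.rowSupport_source, Finset.sum_union, Finset.sum_biUnion]
  · intro m hm m' hm' hne
    refine Finset.disjoint_left.2 fun j h1 h2 => ?_
    exact mem_rowSupport.1 h2 (h.eq_zero_of_ne m hm m' hm' hne.symm j (mem_rowSupport.1 h1))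
  · refine Finset.disjoint_left.2 fun j h1 h2 => ?_
    obtain ⟨m, hm, h3⟩ := Finset.mem_biUnion.1 h2
    exact mem_rowSupport.1 h3 (h.eq_zero_of_mem m hm j h1)

theorem sum_rowSupport_target (h : IsTransferOfSupports B C p K M) {G : Type*} [AddCommMonoid G]
    (f : ι → G) : ∑ j ∈ rowSupport hC p, f j = ∑ j ∈ K, f j + ∑ m ∈ M, f m := by
  classical
  rw [h.rowSupport_target, Finset.sum_union h.disjoint]

/-! ### Passing between families of a matrix and of its primitive transfer. -/

open Classical in
/-- The partial isometries for the primitive transfer `C`, in terms of those for `B`. -/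
noncomputable def targetEntry (K : Finset ι) (p : ι) (x : CuntzKriegerFamily (ofMatrix B) hB A)
    (i j : ι) : A :=
  if i = p then
    if j ∈ K then x.entry p j
    -- Only `j ∈ M` matters here: outside `K ∪ M` the entry `C p j` is zero and this value is never
    -- used.
    else ∑ l ∈ rowSupport hB j, x.entry p l * star (x.entry j l)
  else x.entry i j

open Classical in
/-- The partial isometries for `B`, in terms of those for its primitive transfer `C`. -/
noncomputable def sourceEntry (K M : Finset ι) (p : ι)
    (y : CuntzKriegerFamily (ofMatrix C) hC A) (i j : ι) : A :=
  if i = p then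
    -- At most one `m ∈ M` has `B m j ≠ 0`; summing over `M` avoids choosing it.
    if j ∈ K then y.entry p j else ∑ m ∈ M, y.entry p m * y.entry m j
  else y.entry i j

section Entries

variable (x : CuntzKriegerFamily (ofMatrix B) hB A) (y : CuntzKriegerFamily (ofMatrix C) hC A)

theorem targetEntry_of_ne {i : ι} (hi : i ≠ p) (j : ι) : targetEntry K p x i j = x.entry i j :=
  if_neg hi

theorem targetEntry_of_mem {j : ι} (hj : j ∈ K) : targetEntry K p x p j = x.entry p j := by
  rw [targetEntry, if_pos rfl, if_pos hj]

theorem targetEntry_of_mem_right (h : IsTransferOfSupports B C p K M) {m : ι} (hm : m ∈ M) :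
    targetEntry K p x p m = ∑ l ∈ rowSupport hB m, x.entry p l * star (x.entry m l) := by
  rw [targetEntry, if_pos rfl, if_neg (Finset.disjoint_right.1 h.disjoint hm)]

theorem sourceEntry_of_ne {i : ι} (hi : i ≠ p) (j : ι) : sourceEntry K M p y i j = y.entry i j :=
  if_neg hi

theorem sourceEntry_of_mem {j : ι} (hj : j ∈ K) : sourceEntry K M p y p j = y.entry p j := by
  rw [sourceEntry, if_pos rfl, if_pos hj]

theorem sourceEntry_of_mem_right (h : IsTransferOfSupports B C p K M) {m j : ι} (hm : m ∈ M)
    (hj : B m j ≠ 0) : sourceEntry K M p y p j = y.entry p m * y.entry m j := by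
  rw [sourceEntry, if_pos rfl, if_neg fun hK => hj (h.eq_zero_of_mem m hm j hK)]
  refine Finset.sum_eq_single m (fun m' hm' hne => ?_) fun hm' => absurd hm hm'
  rw [y.entry_of_eq (i := m'), mul_zero]
  rw [h.row_eq m' (h.ne_of_mem hm')]
  exact h.eq_zero_of_ne m hm m' hm' hne j hj

theorem source_ne_of_mem (h : IsTransferOfSupports B C p K M) {m j : ι} (hm : m ∈ M)
    (hj : B m j ≠ 0) : B p j ≠ 0 :=
  (h.source_ne_iff j).2 (Or.inr ⟨m, hm, hj⟩)

theorem target_ne_of_mem (h : IsTransferOfSupports B C p K M) {m j : ι} (hm : m ∈ M)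
    (hj : B m j ≠ 0) : C m j ≠ 0 := by
  rwa [h.row_eq m (h.ne_of_mem hm)]

/-- For `j ∈ M` the cross terms S_{p,l}^* S_{p,k} vanish, which leaves ∑_l S_{j,l} P_l S_{j,l}^* =
P_j; the last equality needs `B j ≠ 0`. -/
theorem star_targetEntry_mul (h : IsTransferOfSupports B C p K M) {i j : ι} (hij : C i j ≠ 0) :
    star (targetEntry K p x i j) * targetEntry K p x i j = x.diag j := by
  by_cases hi : i = p
  · subst hi
    rcases (h.target_ne_iff j).1 hij with hj | hj
    · rw [targetEntry_of_mem x hj]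
      exact x.star_entry_mul_entry ((h.source_ne_iff j).2 (Or.inl hj))
    · rw [targetEntry_of_mem_right x h hj, star_sum, Finset.sum_mul,
        x.diag_eq_sum (h.row_ne_of_mem j hj) (fun _ => mem_rowSupport (hB := hB))]
      refine Finset.sum_congr rfl fun l hl => ?_
      rw [Finset.mul_sum, Finset.sum_eq_single l]
      · rw [star_mul, star_star, mul_assoc, ← mul_assoc (star _) (x.entry i l),
          x.star_entry_mul_entry (h.source_ne_of_mem hj (mem_rowSupport.1 hl)),
          x.diag_mul_star_entry]
      · intro k _ hk
        rw [star_mul, star_star, mul_assoc, ← mul_assoc (star _) (x.entry i k),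
          x.star_entry_mul_entry_of_ne hk.symm, zero_mul, mul_zero]
      · exact fun h' => absurd hl h'
  · rw [targetEntry_of_ne x hi]
    rw [h.row_eq i hi] at hij
    exact x.star_entry_mul_entry hij

/-- The range projection of T_{p,m} is exactly the `m`-block of the Cuntz–Krieger sum of `B` at `p`.
-/
theorem targetEntry_mul_star (h : IsTransferOfSupports B C p K M) {m : ι} (hm : m ∈ M) :
    targetEntry K p x p m * star (targetEntry K p x p m) =
      ∑ l ∈ rowSupport hB m, x.entry p l * star (x.entry p l) := by
  rw [targetEntry_of_mem_right x h hm, star_sum, Finset.sum_mul]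
  refine Finset.sum_congr rfl fun l hl => ?_
  rw [Finset.mul_sum, Finset.sum_eq_single l]
  · rw [star_mul, star_star, mul_assoc, ← mul_assoc (star _) (x.entry m l),
      x.star_entry_mul_entry (mem_rowSupport.1 hl), x.diag_mul_star_entry]
  · intro k _ hk
    rw [star_mul, star_star, mul_assoc, ← mul_assoc (star _) (x.entry m k),
      x.star_entry_mul_entry_of_ne hk.symm, zero_mul, mul_zero]
  · exact fun h' => absurd hl h'

theorem diag_eq_sum_targetEntry (h : IsTransferOfSupports B C p K M) {i : ι} (hi : C i ≠ 0) :
    x.diag i = ∑ j ∈ rowSupport hC i, targetEntry K p x i j * star (targetEntry K p x i j) := by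
  by_cases hip : i = p
  · subst hip
    rw [x.diag_eq_sum h.row_ne (fun _ => mem_rowSupport (hB := hB)), h.sum_rowSupport_source,
      h.sum_rowSupport_target]
    congr 1
    · exact Finset.sum_congr rfl fun j hj => by rw [targetEntry_of_mem x hj]
    · exact Finset.sum_congr rfl fun m hm => (targetEntry_mul_star x h hm).symm
  · simp only [targetEntry_of_ne x hip]
    refine x.diag_eq_sum (h.row_eq i hip ▸ hi) fun j => ?_
    rw [mem_rowSupport, h.row_eq i hip]

theorem star_sourceEntry_mul (h : IsTransferOfSupports B C p K M) {i j : ι} (hij : B i j ≠ 0) :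
    star (sourceEntry K M p y i j) * sourceEntry K M p y i j = y.diag j := by
  by_cases hi : i = p
  · subst hi
    rcases (h.source_ne_iff j).1 hij with hj | ⟨m, hm, hj⟩
    · rw [sourceEntry_of_mem y hj]
      exact y.star_entry_mul_entry ((h.target_ne_iff j).2 (Or.inl hj))
    · rw [sourceEntry_of_mem_right y h hm hj, star_mul, mul_assoc,
        ← mul_assoc (star _) (y.entry i m),
        y.star_entry_mul_entry ((h.target_ne_iff m).2 (Or.inr hm)), y.diag_mul_entry,
        y.star_entry_mul_entry (h.target_ne_of_mem hm hj)]
  · rw [sourceEntry_of_ne y hi]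
    exact y.star_entry_mul_entry (by rwa [h.row_eq i hi])

theorem sum_entry_mul_star_of_mem (h : IsTransferOfSupports B C p K M) {m : ι} (hm : m ∈ M) :
    ∑ l ∈ rowSupport hB m, y.entry m l * star (y.entry m l) = y.diag m := by
  refine (y.diag_eq_sum ?_ fun l => ?_).symm
  · rw [h.row_eq m (h.ne_of_mem hm)]
    exact h.row_ne_of_mem m hm
  · rw [mem_rowSupport, h.row_eq m (h.ne_of_mem hm)]

theorem diag_eq_sum_sourceEntry (h : IsTransferOfSupports B C p K M) {i : ι} (hi : B i ≠ 0) :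
    y.diag i =
      ∑ j ∈ rowSupport hB i, sourceEntry K M p y i j * star (sourceEntry K M p y i j) := by
  by_cases hip : i = p
  · subst hip
    rw [y.diag_eq_sum h.target_row_ne (fun _ => mem_rowSupport (hB := hC)),
      h.sum_rowSupport_source, h.sum_rowSupport_target]
    congr 1
    · exact Finset.sum_congr rfl fun j hj => by rw [sourceEntry_of_mem y hj]
    · refine Finset.sum_congr rfl fun m hm => ?_
      -- Insert P_m between the two factors and expand it over row `m`: this recovers the `m`-block
      -- for `B`.
      calc y.entry i m * star (y.entry i m)
          = y.entry i m * (∑ l ∈ rowSupport hB m, y.entry m l * star (y.entry m l)) *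
              star (y.entry i m) := by
            rw [sum_entry_mul_star_of_mem y h hm, y.entry_mul_diag]
        _ = _ := by
            rw [Finset.mul_sum, Finset.sum_mul]
            refine Finset.sum_congr rfl fun l hl => ?_
            rw [sourceEntry_of_mem_right y h hm (mem_rowSupport.1 hl), star_mul]
            simp only [mul_assoc]
  · simp only [sourceEntry_of_ne y hip]
    refine y.diag_eq_sum (by rwa [h.row_eq i hip]) fun j => ?_
    rw [mem_rowSupport, h.row_eq i hip]

/-- The Cuntz–Krieger family for a primitive transfer. -/
noncomputable def targetFamily (h : IsTransferOfSupports B C p K M) :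
    CuntzKriegerFamily (ofMatrix C) hC A :=
  ofEntries hC x.diag (targetEntry K p x) x.isStarProjection x.orthogonal
    (fun _ _ hij => star_targetEntry_mul x h hij) (fun _ hi => diag_eq_sum_targetEntry x h hi)

/-- The Cuntz–Krieger family for a matrix from one for its primitive transfer. -/
noncomputable def sourceFamily (h : IsTransferOfSupports B C p K M) :
    CuntzKriegerFamily (ofMatrix B) hB A :=
  ofEntries hB y.diag (sourceEntry K M p y) y.isStarProjection y.orthogonal
    (fun _ _ hij => star_sourceEntry_mul y h hij) (fun _ hi => diag_eq_sum_sourceEntry y h hi)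

theorem entry_targetFamily (h : IsTransferOfSupports B C p K M) {i j : ι} (hij : C i j ≠ 0) :
    (targetFamily (hC := hC) x h).entry i j = targetEntry K p x i j :=
  entry_of_ne _ hij

theorem entry_sourceFamily (h : IsTransferOfSupports B C p K M) {i j : ι} (hij : B i j ≠ 0) :
    (sourceFamily (hB := hB) y h).entry i j = sourceEntry K M p y i j :=
  entry_of_ne _ hij

/-- At `p`, T_{p,m} T_{m,j} = ∑_l S_{p,l} S_{m,l}^* S_{m,j}, in which only l = j survives, giving
S_{p,j} P_j = S_{p,j}. -/
theorem sourceFamily_targetFamily (h : IsTransferOfSupports B C p K M) :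
    sourceFamily (hB := hB) (targetFamily (hC := hC) x h) h = x := by
  refine ext_entry (fun _ => rfl) fun i j hij => ?_
  rw [entry_sourceFamily _ h hij]
  by_cases hi : i = p
  · subst hi
    rcases (h.source_ne_iff j).1 hij with hj | ⟨m, hm, hj⟩
    · rw [sourceEntry_of_mem _ hj, entry_targetFamily x h ((h.target_ne_iff j).2 (Or.inl hj)),
        targetEntry_of_mem x hj]
    · rw [sourceEntry_of_mem_right _ h hm hj,
        entry_targetFamily x h ((h.target_ne_iff m).2 (Or.inr hm)),
        entry_targetFamily x h (h.target_ne_of_mem hm hj), targetEntry_of_mem_right x h hm,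
        targetEntry_of_ne x (h.ne_of_mem hm), Finset.sum_mul, Finset.sum_eq_single j]
      · rw [mul_assoc, x.star_entry_mul_entry hj, x.entry_mul_diag]
      · intro l _ hl
        rw [mul_assoc, x.star_entry_mul_entry_of_ne hl, mul_zero]
      · exact fun h' => absurd (mem_rowSupport.2 hj) h'
  · rw [sourceEntry_of_ne _ hi, entry_targetFamily x h (by rwa [h.row_eq i hi]),
      targetEntry_of_ne x hi]

/-- At `p`, ∑_l T_{p,m} T_{m,l} T_{m,l}^* = T_{p,m} P_m = T_{p,m}. -/
theorem targetFamily_sourceFamily (h : IsTransferOfSupports B C p K M) :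
    targetFamily (hC := hC) (sourceFamily (hB := hB) y h) h = y := by
  refine ext_entry (fun _ => rfl) fun i j hij => ?_
  rw [entry_targetFamily _ h hij]
  by_cases hi : i = p
  · subst hi
    rcases (h.target_ne_iff j).1 hij with hj | hj
    · rw [targetEntry_of_mem _ hj, entry_sourceFamily y h ((h.source_ne_iff j).2 (Or.inl hj)),
        sourceEntry_of_mem y hj]
    · rw [targetEntry_of_mem_right _ h hj, ← y.entry_mul_diag (i := i) (j := j),
        ← sum_entry_mul_star_of_mem (hB := hB) y h hj, Finset.mul_sum]
      refine Finset.sum_congr rfl fun l hl => ?_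
      have hl' := mem_rowSupport.1 hl
      rw [entry_sourceFamily y h (h.source_ne_of_mem hj hl'), entry_sourceFamily y h hl',
        sourceEntry_of_mem_right y h hj hl', sourceEntry_of_ne y (h.ne_of_mem hj), mul_assoc]
  · rw [targetEntry_of_ne _ hi, entry_sourceFamily y h (by rwa [← h.row_eq i hi]),
      sourceEntry_of_ne y hi]

theorem targetFamily_map (h : IsTransferOfSupports B C p K M) (φ : A →⋆ₙₐ[ℂ] A') :
    targetFamily (hC := hC) (x.map φ) h = (targetFamily x h).map φ := by
  refine ext_entry (fun _ => rfl) fun i j hij => ?_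
  rw [entry_targetFamily _ h hij, map_entry, entry_targetFamily _ h hij]
  unfold targetEntry
  split_ifs <;> simp only [map_entry, map_sum, map_mul, map_star]

theorem sourceFamily_map (h : IsTransferOfSupports B C p K M) (φ : A →⋆ₙₐ[ℂ] A') :
    sourceFamily (hB := hB) (y.map φ) h = (sourceFamily y h).map φ := by
  refine ext_entry (fun _ => rfl) fun i j hij => ?_
  rw [entry_sourceFamily _ h hij, map_entry, entry_sourceFamily _ h hij]
  unfold sourceEntry
  split_ifs <;> simp only [map_entry, map_sum, map_mul]

end Entries

theorem nonempty_starAlgEquiv (h : IsTransferOfSupports B C p K M) :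
    Nonempty ((ofMatrix B).graphCStarAlgebra hB ≃⋆ₐ[ℂ] (ofMatrix C).graphCStarAlgebra hC) :=
  nonempty_starAlgEquiv_of_natural (fun x => targetFamily x h) (fun y => sourceFamily y h)
    (fun φ x => targetFamily_map x h φ) (fun φ y => sourceFamily_map y h φ)
    (fun x => sourceFamily_targetFamily x h) (fun y => targetFamily_sourceFamily y h)

end IsTransferOfSupports

/-! ### From matrices back to graphs, and chains of primitive steps. -/

namespace DirectedGraph

variable {ι : Type u}

/-- The edges of a graph without multiple edges are the nonzero entries of its vertex matrix. -/
theorem NoMultipleEdges.vertexMatrix_ne_zero_iff {E : DirectedGraph.{u}} (hE : E.NoMultipleEdges)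
    (v w : E.Vertex) : E.vertexMatrix v w ≠ 0 ↔ ∃ e, E.source e = v ∧ E.range e = w := by
  have hsub : {e : E.Edge | E.source e = v ∧ E.range e = w}.Subsingleton :=
    fun e he f hf => hE e f (he.1.trans hf.1.symm) (he.2.trans hf.2.symm)
  exact Nat.pos_iff_ne_zero.symm.trans (Set.ncard_pos hsub.finite)

/-- The bijection between the edges of a graph without multiple edges and the nonzero entries of its
vertex matrix, reindexed along `σ`. -/
noncomputable def NoMultipleEdges.edgeEquiv {E : DirectedGraph.{u}} (hE : E.NoMultipleEdges)
    (σ : ι ≃ E.Vertex) : E.Edge ≃ (ofMatrix (E.vertexMatrix.submatrix σ σ)).Edge :=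
  Equiv.ofBijective
    (fun e => ⟨(σ.symm (E.source e), σ.symm (E.range e)), by
      simpa using (hE.vertexMatrix_ne_zero_iff _ _).2 ⟨e, rfl, rfl⟩⟩)
    ⟨fun e f h => by
      have h' := congrArg Subtype.val h
      simp only [Prod.mk.injEq, EmbeddingLike.apply_eq_iff_eq] at h'
      exact hE e f h'.1 h'.2,
    fun ⟨⟨i, j⟩, h⟩ => by
      obtain ⟨e, h1, h2⟩ := (hE.vertexMatrix_ne_zero_iff (σ i) (σ j)).1 h
      exact ⟨e, Subtype.ext (by simp [h1, h2])⟩⟩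

/-- If `E` is row-finite, then so is `F`, and their `C⋆`-algebras are isomorphic. -/
def CStarEquivalent (E F : DirectedGraph.{u}) : Prop :=
  ∀ hE : E.RowFinite, ∃ hF : F.RowFinite,
    Nonempty (E.graphCStarAlgebra hE ≃⋆ₐ[ℂ] F.graphCStarAlgebra hF)

theorem CStarEquivalent.trans {E F G : DirectedGraph.{u}} (h : CStarEquivalent E F)
    (h' : CStarEquivalent F G) : CStarEquivalent E G := fun hE => by
  obtain ⟨hF, ⟨e⟩⟩ := h hE
  obtain ⟨hG, ⟨f⟩⟩ := h' hF
  exact ⟨hG, ⟨e.trans f⟩⟩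

theorem CStarEquivalent.of_equiv {E F : DirectedGraph.{u}} (σ : E.Vertex ≃ F.Vertex)
    (τ : E.Edge ≃ F.Edge) (hs : ∀ e, F.source (τ e) = σ (E.source e))
    (hr : ∀ e, F.range (τ e) = σ (E.range e)) :
    CStarEquivalent E F ∧ CStarEquivalent F E := by
  have hs' (e) : E.source (τ.symm e) = σ.symm (F.source e) := by
    rw [Equiv.eq_symm_apply, ← hs, Equiv.apply_symm_apply]
  refine ⟨fun hE => ⟨hE.of_equiv σ.symm τ.symm hs', nonempty_starAlgEquiv_of_equiv σ τ hs hr⟩,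
    fun hF => ⟨hF.of_equiv σ τ hs, ?_⟩⟩
  exact (nonempty_starAlgEquiv_of_equiv σ τ hs hr).map StarAlgEquiv.symm

theorem NoMultipleEdges.cStarEquivalent {E : DirectedGraph.{u}} (hE : E.NoMultipleEdges)
    (σ : ι ≃ E.Vertex) :
    CStarEquivalent E (ofMatrix (E.vertexMatrix.submatrix σ σ)) ∧
      CStarEquivalent (ofMatrix (E.vertexMatrix.submatrix σ σ)) E :=
  CStarEquivalent.of_equiv (F := ofMatrix (E.vertexMatrix.submatrix σ σ)) σ.symm (hE.edgeEquiv σ)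
    (fun _ => rfl) (fun _ => rfl)

end DirectedGraph

open DirectedGraph

/-- Both directions are recorded because `CStarEquivalent` transfers row-finiteness one way only,
while a primitive step may run either way. -/
theorem IsPrimitiveTransfer.cStarEquivalent {ι : Type u} {D D' : Matrix ι ι ℕ}
    (h : IsPrimitiveTransfer D D') :
    CStarEquivalent (ofMatrix D) (ofMatrix D') ∧ CStarEquivalent (ofMatrix D') (ofMatrix D) := by
  obtain ⟨p, hp⟩ := h
  obtain ⟨K, M, hKM⟩ := hp.exists_isTransferOfSupports
  exact ⟨fun hD => ⟨hKM.rowFinite_iff.1 hD, hKM.nonempty_starAlgEquiv⟩,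
    fun hD => ⟨hKM.rowFinite_iff.2 hD, hKM.nonempty_starAlgEquiv.map StarAlgEquiv.symm⟩⟩

theorem PrimitiveStep.cStarEquivalent {ι : Type u} {D D' : Matrix ι ι ℕ}
    (h : PrimitiveStep D D') : CStarEquivalent (ofMatrix D) (ofMatrix D') := by
  rcases h with h | h | ⟨σ, rfl⟩
  · exact h.cStarEquivalent.2
  · exact h.cStarEquivalent.1
  · exact (CStarEquivalent.of_equiv (E := ofMatrix (D'.submatrix σ σ)) (F := ofMatrix D') σ
      ((Equiv.prodCongr σ σ).subtypeEquiv fun _ => Iff.rfl) (fun _ => rfl) (fun _ => rfl)).1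

theorem mainTheorem1 (E F : DirectedGraph.{u})
    [Countable E.Vertex] [Countable F.Vertex]
    (hE : E.RowFinite) (hEm : E.NoMultipleEdges) (hFm : F.NoMultipleEdges)
    (h : DirectedGraph.PrimitivelyEquivalent E F) :
    ∃ hF : F.RowFinite, Nonempty (E.graphCStarAlgebra hE ≃⋆ₐ[ℂ] F.graphCStarAlgebra hF) := by
  obtain ⟨σ, -, -, hσ⟩ := h
  have key : CStarEquivalent (ofMatrix E.vertexMatrix)
      (ofMatrix (F.vertexMatrix.submatrix σ σ)) := by
    -- The induction along the chain requires its endpoint to be a variable.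
    generalize F.vertexMatrix.submatrix σ σ = D at hσ
    induction hσ with
    | refl => exact fun hE => ⟨hE, ⟨StarAlgEquiv.refl ..⟩⟩
    | tail _ hstep ih => exact ih.trans hstep.cStarEquivalent
  exact ((hEm.cStarEquivalent (Equiv.refl _)).1.trans (key.trans (hFm.cStarEquivalent σ).2)) hE
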